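/- Let $n \ge 4$ be an integer and let $P_n$ denote the path on $n$ vertices. All graphs are finite and simple. For a graph $G$, its $P_n$-line graph $HL(G)$ is the graph whose vertices are the edges of $G$, where two vertices of $HL(G)$ are adjacent if and only if, as edges of $G$, they are distinct, share an end vertex, and lie in a common subgraph of $G$ isomorphic to $P_n$. Put $HL^0(G)=G$ and $HL^{k+1}(G)=HL(HL^k(G))$ for $k\ge 0$. The circumference of a graph is the length of a longest cycle in it ($0$ if it has no cycle), and $C_m$ denotes the cycle on $m$ vertices. Theorem. Let $G$ be a graph and let $G'\subseteq G$ be a connected subgraph of circumference $m\ge n$ such that $G'\not\cong C_m$. Then the sequence $\{HL^k(G)\}_{k\ge 0}$ diverges by order; that is, for every positive integer $N$ there is an integer $k\ge 0$ such that $|V(HL^k(G))|\ge N$. -/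

import Mathlib

universe u w

namespace HLine

/-- Two edges `e` and `f` of `G` are `H`-adjacent if they are adjacent (distinct and sharing an
end vertex) and lie in a common subgraph of `G` that is isomorphic to `H`. -/
def HAdjacent {W : Type w} {V : Type u} (H : SimpleGraph W) (G : SimpleGraph V)
    (e f : G.edgeSet) : Prop :=
  G.lineGraph.Adj e f ∧
    ∃ S : G.Subgraph, Nonempty (H ≃g S.coe) ∧ (e : Sym2 V) ∈ S.edgeSet ∧ (f : Sym2 V) ∈ S.edgeSet

/-- The `H`-line graph of `G`: its vertices are the edges of `G`, and two of them are adjacent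
if they are `H`-adjacent in `G`. -/
def hLineGraph {W : Type w} {V : Type u} (H : SimpleGraph W) (G : SimpleGraph V) :
    SimpleGraph G.edgeSet where
  Adj e f := HAdjacent H G e f
  symm := ⟨fun _ _ h => ⟨h.1.symm, h.2.imp fun _ hS => ⟨hS.1, hS.2.2, hS.2.1⟩⟩⟩
  loopless := ⟨fun _ h => h.1.ne rfl⟩

/-- The iterated `H`-line graphs `HL^k(G)`, each given together with its vertex type:
`HL^0(G) = G` and `HL^{k+1}(G) = HL(HL^k(G))`. -/
def hLineIter {W : Type w} {V : Type u} (H : SimpleGraph W) (G : SimpleGraph V) :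
    ℕ → Σ X : Type u, SimpleGraph X
  | 0 => ⟨V, G⟩
  | k + 1 => ⟨(hLineIter H G k).2.edgeSet, hLineGraph H (hLineIter H G k).2⟩

/-- The sequence of iterated `H`-line graphs of the (finite) graph `G` diverges by order:
for every positive integer `N` some iterate has at least `N` vertices. -/
def DivergesByOrder {W : Type w} {V : Type u} (H : SimpleGraph W) (G : SimpleGraph V) : Prop :=
  ∀ N : ℕ, 0 < N → ∃ k : ℕ, N ≤ Nat.card (hLineIter H G k).1

/-- The circumference of a (finite) graph: the length of a longest cycle, and `0` if there is
no cycle. (On a finite graph the set of cycle lengths is finite, and `sSup ∅ = 0`.) -/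
noncomputable def circumference {V : Type u} (G : SimpleGraph V) : ℕ :=
  sSup {l : ℕ | ∃ (v : V) (c : G.Walk v v), c.IsCycle ∧ c.length = l}

end HLine

/-! Two consecutive edges of a path on at least `n` vertices are adjacent in the `P_n`-line graph: a
window of `n` path vertices covers both. Let a cycle of length `k ≥ n` have edges `e_0, …, e_{k-1}`,
with `e_{k-1}` and `e_0` meeting at `v 0`, and let `c` be a chord at `v 0`. Hamiltonian paths of
cycle plus chord show that `c, e_0, …, e_{k-1}` is again a cycle, of length `k + 1`, with a chord
from `c` to an edge at the other end of `c` (`HasChordedCycle.hLineGraph_succ`). So chorded cycles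
grow by one at each iterate, and the order is unbounded. A pendant edge at `v 0` can be inserted in
the same way; the adjacency of `e_{k-1}` and `e_0` then becomes the chord
(`HasPendantCycle.hLineGraph_succ`). A connected graph with an `m`-cycle, but no chord or pendant
edge on any `m`-cycle, is `C_m` (`IsPeriodicCycle.nonempty_iso`). -/

namespace HLine

open SimpleGraph

/-! ### Paths and adjacency in the `P_n`-line graph -/

section Paths

variable {V : Type u}

/-- `v 0, …, v (l - 1)` is a path with `l` vertices in `G`. -/
structure IsPathSeq (G : SimpleGraph V) (l : ℕ) (v : ℕ → V) : Prop where
  inj : ∀ i < l, ∀ j < l, v i = v j → i = j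
  adj : ∀ i, i + 1 < l → G.Adj (v i) (v (i + 1))

/-- `v 0, …, v (k - 1), v k = v 0` is a cycle of length `k` in `G` (when `3 ≤ k`). -/
structure IsCycleSeq (G : SimpleGraph V) (k : ℕ) (v : ℕ → V) : Prop where
  inj : ∀ i < k, ∀ j < k, v i = v j → i = j
  closed : v k = v 0
  adj : ∀ i < k, G.Adj (v i) (v (i + 1))

/-- `G` contains a cycle of length `k` together with a chord. -/
def HasChordedCycle (G : SimpleGraph V) (k : ℕ) : Prop :=
  ∃ v : ℕ → V, IsCycleSeq G k v ∧ ∃ j, 2 ≤ j ∧ j + 2 ≤ k ∧ G.Adj (v 0) (v j)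

/-- `G` contains a cycle of length `k` together with a pendant edge. -/
def HasPendantCycle (G : SimpleGraph V) (k : ℕ) : Prop :=
  ∃ v : ℕ → V, IsCycleSeq G k v ∧ ∃ x, (∀ i < k, v i ≠ x) ∧ G.Adj (v 0) x

/-- `H`-adjacency, for elements of `Sym2 V` which need not be edges of `G`. -/
def SymHAdj {W : Type w} (H : SimpleGraph W) (G : SimpleGraph V) (e f : Sym2 V) : Prop :=
  ∃ (he : e ∈ G.edgeSet) (hf : f ∈ G.edgeSet), HAdjacent H G ⟨e, he⟩ ⟨f, hf⟩

theorem SymHAdj.symm {W : Type w} {H : SimpleGraph W} {G : SimpleGraph V} {e f : Sym2 V}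
    (h : SymHAdj H G e f) : SymHAdj H G f e :=
  let ⟨he, hf, h⟩ := h
  ⟨hf, he, (hLineGraph H G).symm.symm _ _ h⟩

theorem HasChordedCycle.of_symHAdj {W : Type w} {H : SimpleGraph W} {G : SimpleGraph V} {k j : ℕ}
    {w : ℕ → Sym2 V} (inj : ∀ i < k, ∀ j < k, w i = w j → i = j) (closed : w k = w 0)
    (adj : ∀ i < k, SymHAdj H G (w i) (w (i + 1))) (hj : 2 ≤ j) (hjk : j + 2 ≤ k)
    (chord : SymHAdj H G (w 0) (w j)) : HasChordedCycle (hLineGraph H G) k := by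
  classical
  have hw : ∀ i ≤ k, w i ∈ G.edgeSet := by
    intro i hi
    rcases hi.lt_or_eq with h | rfl
    · exact (adj i h).1
    · exact closed ▸ chord.1
  -- Values beyond `k` are never used; `w 0` is only a filler.
  let e : ℕ → G.edgeSet := fun i => if h : i ≤ k then ⟨w i, hw i h⟩ else ⟨w 0, chord.1⟩
  have he : ∀ i (h : i ≤ k), e i = ⟨w i, hw i h⟩ := fun i h => dif_pos h
  refine ⟨e, ⟨fun i hi j hj h => ?_, ?_, fun i hi => ?_⟩, j, hj, hjk, ?_⟩
  · rw [he i hi.le, he j hj.le] at h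
    exact inj i hi j hj (congrArg Subtype.val h)
  · rw [he k le_rfl, he 0 (Nat.zero_le _)]
    exact Subtype.ext closed
  · rw [he i hi.le, he (i + 1) hi]
    exact (adj i hi).2.2
  · rw [he 0 (Nat.zero_le _), he j (by lia)]
    exact chord.2.2

theorem IsPathSeq.symHAdj {G : SimpleGraph V} {l n : ℕ} {p : ℕ → V} (hp : IsPathSeq G l p)
    (hn : 3 ≤ n) (hnl : n ≤ l) {i : ℕ} (hi : i + 2 < l) :
    SymHAdj (pathGraph n) G s(p i, p (i + 1)) s(p (i + 1), p (i + 2)) := by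
  -- The window of `n` vertices starts at `i`, or is the last one when that would overrun the path.
  obtain ⟨o, ho, hol, hio⟩ : ∃ o, o ≤ i ∧ o + n ≤ l ∧ i + 2 < o + n :=
    ⟨min i (l - n), by lia, by lia, by lia⟩
  let φ : pathGraph n →g G :=
    { toFun := fun a => p (o + a)
      map_rel' := by
        intro a b hab
        have ha := a.2
        have hb := b.2
        rcases pathGraph_adj.1 hab with h | h
        · rw [← h]
          exact hp.adj (o + a) (by lia)
        · rw [← h]
          exact (hp.adj (o + b) (by lia)).symm }
  have hφ : Function.Injective φ := by
    intro a b hab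
    have ha := a.2
    have hb := b.2
    have := hp.inj _ (by lia) _ (by lia) (show p (o + a) = p (o + b) from hab)
    exact Fin.ext (by lia)
  let c : Copy (pathGraph n) G := ⟨φ, hφ⟩
  have key : ∀ t, o ≤ t → t + 1 < o + n → s(p t, p (t + 1)) ∈ c.toSubgraph.edgeSet := by
    intro t ht htn
    rw [Subgraph.mem_edgeSet]
    refine ⟨⟨t - o, by lia⟩, ⟨t + 1 - o, by lia⟩, ?_, ?_, ?_⟩
    · exact pathGraph_adj.2 (Or.inl (by simp only; lia))
    · exact congrArg p (show o + (t - o) = t by lia)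
    · exact congrArg p (show o + (t + 1 - o) = t + 1 by lia)
  refine ⟨hp.adj i (by lia), hp.adj (i + 1) hi, ?_, c.toSubgraph, ⟨c.isoToSubgraph⟩,
    key i ho (by lia), key (i + 1) (by lia) (by lia)⟩
  rw [lineGraph_adj_iff_exists]
  refine ⟨fun h => ?_, p (i + 1), by simp, by simp⟩
  have h' := congrArg Subtype.val h
  have h02 : p i ≠ p (i + 2) := fun h => by
    have := hp.inj _ (by lia) _ hi h
    lia
  have h01 : p i ≠ p (i + 1) := (hp.adj i (by lia)).ne
  simp only [Sym2.eq_iff] at h'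
  tauto

/-- A variant of `IsPathSeq.symHAdj` in which the three vertices are given by name. -/
theorem IsPathSeq.symHAdj_of_eq {G : SimpleGraph V} {l n : ℕ} {p : ℕ → V} (hp : IsPathSeq G l p)
    (hn : 3 ≤ n) (hnl : n ≤ l) (i : ℕ) {x y z : V} (hi : i + 2 < l) (hx : p i = x)
    (hy : p (i + 1) = y) (hz : p (i + 2) = z) : SymHAdj (pathGraph n) G s(x, y) s(y, z) := by
  subst hx hy hz
  exact hp.symHAdj hn hnl hi

end Paths

/-! ### Growing cycles with a chord or a pendant edge -/

section Cycles

variable {V : Type u} {G : SimpleGraph V} {k n : ℕ} {v : ℕ → V}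

theorem IsCycleSeq.isPathSeq (h : IsCycleSeq G k v) : IsPathSeq G k v :=
  ⟨h.inj, fun i hi => h.adj i (by lia)⟩

theorem IsCycleSeq.inj_succ (h : IsCycleSeq G k v) :
    ∀ i < k, ∀ j < k, v (i + 1) = v (j + 1) → i = j := by
  have h1 := h.inj
  have h2 := h.closed
  intro i hi j hj hij
  rcases (show i + 1 ≤ k from hi).lt_or_eq with a | a <;>
    rcases (show j + 1 ≤ k from hj).lt_or_eq with b | b
  · have := h1 _ a _ b hij
    lia
  · rw [b, h2] at hij
    have := h1 _ a _ (by lia) hij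
    lia
  · rw [a, h2] at hij
    have := h1 _ (by lia) _ b hij
    lia
  · lia

theorem IsCycleSeq.isPathSeq_succ (h : IsCycleSeq G k v) :
    IsPathSeq G k (fun i => v (i + 1)) :=
  ⟨h.inj_succ, fun i hi => h.adj (i + 1) hi⟩

theorem IsCycleSeq.edge_inj (h : IsCycleSeq G k v) (hk : 3 ≤ k) {i j : ℕ} (hi : i < k)
    (hj : j < k) (he : s(v i, v (i + 1)) = s(v j, v (j + 1))) : i = j := by
  have h1 := h.inj
  have h2 := h.closed
  rcases Sym2.eq_iff.1 he with ⟨ha, -⟩ | ⟨ha, hb⟩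
  · exact h1 i hi j hj ha
  · grind

theorem IsCycleSeq.symHAdj_succ (h : IsCycleSeq G k v) (hn : 3 ≤ n) (hk : n ≤ k) {i : ℕ}
    (hi : i + 1 < k) :
    SymHAdj (pathGraph n) G s(v i, v (i + 1)) s(v (i + 1), v (i + 1 + 1)) := by
  rcases (show i + 2 ≤ k from hi).lt_or_eq with h' | h'
  · exact h.isPathSeq.symHAdj hn hk h'
  -- The last triple ends at `v k = v 0`, so the path has to start at `v 1`.
  · exact h.isPathSeq_succ.symHAdj_of_eq hn hk (i - 1) (by lia)
      (congrArg v (by lia)) (congrArg v (by lia)) (congrArg v (by lia))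

/-- The Hamiltonian path `v (j - 1), …, v 0, v j, …, v (k - 1)` of a cycle with chord. -/
theorem IsCycleSeq.isPathSeq_chord (h : IsCycleSeq G k v) {j : ℕ}
    (hjk : j + 2 ≤ k) (hadj : G.Adj (v 0) (v j)) :
    IsPathSeq G k (fun i => if i < j then v (j - 1 - i) else v i) := by
  refine ⟨fun a ha b hb hab => ?_, fun i hi => ?_⟩
  · have h1 := h.inj
    grind
  · rcases lt_trichotomy (i + 1) j with h' | h' | h'
    · rw [if_pos (by lia), if_pos h']
      have := h.adj (j - 1 - (i + 1)) (by lia)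
      rw [show j - 1 - (i + 1) + 1 = j - 1 - i by lia] at this
      exact this.symm
    · rw [if_pos (by lia), if_neg (by lia), h', show j - 1 - i = 0 by lia]
      exact hadj
    · rw [if_neg (by lia), if_neg (by lia)]
      exact h.adj i (by lia)

/-- The Hamiltonian path `v (j + 1), …, v k, v j, …, v 1` of a cycle with chord. -/
theorem IsCycleSeq.isPathSeq_chord' (h : IsCycleSeq G k v) {j : ℕ} (hj : 2 ≤ j)
    (hjk : j + 2 ≤ k) (hadj : G.Adj (v 0) (v j)) :
    IsPathSeq G k (fun i => if i < k - j then v (j + i + 1) else v (k - 1 - i + 1)) := by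
  refine ⟨fun a ha b hb hab => ?_, fun i hi => ?_⟩
  · have h1 := h.inj_succ
    grind
  · rcases lt_trichotomy (i + 1) (k - j) with h' | h' | h'
    · rw [if_pos (by lia), if_pos h']
      exact h.adj (j + i + 1) (by lia)
    · rw [if_pos (by lia), if_neg (by lia), show j + i + 1 = k by lia,
        show k - 1 - (i + 1) + 1 = j by lia, h.closed]
      exact hadj
    · rw [if_neg (by lia), if_neg (by lia)]
      have := h.adj (k - 1 - (i + 1) + 1) (by lia)
      rw [show k - 1 - (i + 1) + 1 + 1 = k - 1 - i + 1 by lia] at this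
      exact this.symm

theorem HasChordedCycle.hLineGraph_succ (h : HasChordedCycle G k) (hn : 4 ≤ n) (hk : n ≤ k) :
    HasChordedCycle (hLineGraph (pathGraph n) G) (k + 1) := by
  obtain ⟨v, hv, j, hj, hjk, hadj⟩ := h
  have h1 := hv.inj
  have h2 := hv.closed
  have hce : ∀ i < k, s(v 0, v j) ≠ s(v i, v (i + 1)) := by
    intro i hi he
    rcases Sym2.eq_iff.1 he with ⟨ha, hb⟩ | ⟨ha, hb⟩
    · grind
    · grind
  have hp := hv.isPathSeq_chord hjk hadj
  -- The chord sits between the edges `v (k - 1) v k` and `v 0 v 1`. This shifts indices by one, so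
  -- the edge `v j v (j + 1)`, which meets the chord at `v j`, is `w (j + 1)`.
  let w : ℕ → Sym2 V := fun i =>
    if i = 0 ∨ i = k + 1 then s(v 0, v j) else s(v (i - 1), v (i - 1 + 1))
  have w0 : w 0 = s(v 0, v j) := if_pos (by simp)
  have wk : w (k + 1) = s(v 0, v j) := if_pos (by simp)
  have ws : ∀ i < k, w (i + 1) = s(v i, v (i + 1)) := fun i hi => by
    simp only [w]
    rw [if_neg (by lia)]
    rfl
  refine HasChordedCycle.of_symHAdj (w := w) (j := j + 1) ?_ (by rw [w0, wk]) ?_ (by lia) (by lia)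
    ?_
  · rintro (_ | a) ha (_ | b) hb hab
    · rfl
    · rw [w0, ws b (by lia)] at hab
      exact (hce b (by lia) hab).elim
    · rw [w0, ws a (by lia)] at hab
      exact (hce a (by lia) hab.symm).elim
    · rw [ws a (by lia), ws b (by lia)] at hab
      rw [hv.edge_inj (by lia) (by lia) (by lia) hab]
  · rintro (_ | i) hi
    · rw [w0, ws 0 (by lia)]
      refine SymHAdj.symm ?_
      rw [Sym2.eq_swap]
      exact hp.symHAdj_of_eq (by lia) hk (j - 2) (by lia)
        ((if_pos (by lia)).trans (congrArg v (by lia)))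
        ((if_pos (by lia)).trans (congrArg v (by lia)))
        ((if_neg (by lia)).trans (congrArg v (by lia)))
    · rcases (show i + 1 ≤ k by lia).lt_or_eq with h' | h'
      · rw [ws i (by lia), ws (i + 1) h']
        exact hv.symHAdj_succ (by lia) hk h'
      · rw [ws i (by lia), h', wk, ← h2]
        exact (hv.isPathSeq_chord' hj hjk hadj).symHAdj_of_eq (by lia) hk (k - j - 2) (by lia)
          ((if_pos (by lia)).trans (congrArg v (by lia)))
          ((if_pos (by lia)).trans (congrArg v (by lia)))
          ((if_neg (by lia)).trans (congrArg v (by lia)))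
  · rw [w0, ws j (by lia)]
    exact hp.symHAdj_of_eq (by lia) hk (j - 1) (by lia)
      ((if_pos (by lia)).trans (congrArg v (by lia)))
      ((if_neg (by lia)).trans (congrArg v (by lia)))
      ((if_neg (by lia)).trans (congrArg v (by lia)))

/-- The path `v 1, …, v k, x` obtained from a cycle with pendant edge. -/
theorem IsCycleSeq.isPathSeq_append (h : IsCycleSeq G k v) {x : V} (hk : 0 < k)
    (hx : ∀ i < k, v i ≠ x) (hadj : G.Adj (v 0) x) :
    IsPathSeq G (k + 1) (fun i => if i < k then v (i + 1) else x) := by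
  have h1 := h.inj_succ
  have hx' : ∀ i < k, v (i + 1) ≠ x := fun i hi => by
    rcases (show i + 1 ≤ k from hi).lt_or_eq with h' | h'
    · exact hx _ h'
    · rw [h', h.closed]
      exact hx 0 hk
  refine ⟨fun a ha b hb hab => ?_, fun a ha => ?_⟩
  · split_ifs at hab with h2 h3 h3
    · exact h1 a h2 b h3 hab
    · exact (hx' a h2 hab).elim
    · exact (hx' b h3 hab.symm).elim
    · lia
  · rw [if_pos (by lia)]
    split_ifs with h'
    · exact h.adj _ h'
    · rwa [show a + 1 = k by lia, h.closed]

/-- Prepending a vertex to a path. -/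
theorem IsPathSeq.cons {l : ℕ} {p : ℕ → V} (h : IsPathSeq G l p) {x : V}
    (hx : ∀ i < l, p i ≠ x) (hadj : G.Adj x (p 0)) :
    IsPathSeq G (l + 1) (fun i => if i = 0 then x else p (i - 1)) := by
  refine ⟨?_, ?_⟩
  · rintro (_ | a) ha (_ | b) hb hab
    · rfl
    · exact (hx b (by lia) hab.symm).elim
    · exact (hx a (by lia) hab).elim
    · rw [h.inj a (by lia) b (by lia) hab]
  · rintro (_ | a) ha
    · exact hadj
    · exact h.adj a (by lia)

theorem IsPathSeq.mono {l l' : ℕ} {p : ℕ → V} (h : IsPathSeq G l p) (hl : l' ≤ l) :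
    IsPathSeq G l' p :=
  ⟨fun i hi j hj => h.inj i (by lia) j (by lia), fun i hi => h.adj i (by lia)⟩

theorem HasPendantCycle.hLineGraph_succ (h : HasPendantCycle G k) (hn : 4 ≤ n) (hk : n ≤ k) :
    HasChordedCycle (hLineGraph (pathGraph n) G) (k + 1) := by
  obtain ⟨v, hv, x, hx, hadj⟩ := h
  have h1 := hv.inj
  have h2 := hv.closed
  have hpe : ∀ i < k, s(v 0, x) ≠ s(v i, v (i + 1)) := by
    intro i hi he
    rcases Sym2.eq_iff.1 he with ⟨ha, hb⟩ | ⟨ha, hb⟩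
    · grind
    · grind
  -- The pendant edge is inserted after the last cycle edge; the new chord joins the first and last
  -- cycle edges, `w 0` and `w (k - 1)`.
  let w : ℕ → Sym2 V := fun i =>
    if i < k then s(v i, v (i + 1)) else if i = k then s(v 0, x) else s(v 0, v 1)
  have ws : ∀ i < k, w i = s(v i, v (i + 1)) := fun i hi => if_pos hi
  have wk : w k = s(v 0, x) := by simp [w]
  have wk1 : w (k + 1) = s(v 0, v 1) := by simp [w]
  have w0 : w 0 = s(v 0, v 1) := ws 0 (by lia)
  refine HasChordedCycle.of_symHAdj (w := w) (j := k - 1) ?_ (by rw [w0, wk1]) ?_ (by lia)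
    (by lia) ?_
  · intro a ha b hb hab
    rcases (show a ≤ k by lia).lt_or_eq with ha | ha <;>
      rcases (show b ≤ k by lia).lt_or_eq with hb | hb
    · rw [ws a ha, ws b hb] at hab
      exact hv.edge_inj (by lia) ha hb hab
    · rw [ws a ha, hb, wk] at hab
      exact (hpe a ha hab.symm).elim
    · rw [ws b hb, ha, wk] at hab
      exact (hpe b hb hab).elim
    · rw [ha, hb]
  · intro i hi
    rcases (show i ≤ k by lia).lt_or_eq with hi | rfl
    · rcases (show i + 1 ≤ k by lia).lt_or_eq with h' | h'
      · rw [ws i hi, ws (i + 1) h']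
        exact hv.symHAdj_succ (by lia) hk h'
      · rw [ws i hi, h', wk, ← h2]
        exact (hv.isPathSeq_append (by lia) hx hadj).symHAdj_of_eq (by lia) (by lia) (k - 2)
          (by lia) ((if_pos (by lia)).trans (congrArg v (by lia)))
          ((if_pos (by lia)).trans (congrArg v (by lia))) (if_neg (by lia))
    · rw [wk, wk1, Sym2.eq_swap (a := v 0) (b := x)]
      exact (hv.isPathSeq.cons hx hadj.symm).symHAdj_of_eq (by lia) (by lia) 0 (by lia) rfl rfl rfl
  · rw [w0, ws (k - 1) (by lia), show k - 1 + 1 = k by lia, h2]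
    -- The path `v (k - 1), v 0, …, v (k - 2)`, which passes through `v 0` along both cycle edges
    -- there.
    have hp := (hv.isPathSeq.mono (Nat.sub_le k 1)).cons (x := v (k - 1))
      (fun i hi h => by
        have := h1 i (by lia) (k - 1) (by lia) h
        lia)
      (by
        have := hv.adj (k - 1) (by lia)
        rwa [show k - 1 + 1 = k by lia, h2] at this)
    exact (hp.symHAdj_of_eq (by lia) (by lia) 0 (by lia) rfl rfl rfl).symm

theorem IsCycleSeq.le_card [Finite V] (h : IsCycleSeq G k v) : k ≤ Nat.card V := by
  have := Nat.card_le_card_of_injective (fun i : Fin k => v i)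
    (fun a b hab => Fin.ext (h.inj a a.2 b b.2 hab))
  simpa using this

end Cycles

/-! ### Divergence from a chorded cycle -/

section Iterates

variable {V : Type u} {W : Type w} {G : SimpleGraph V}

theorem finite_hLineIter [Finite V] (H : SimpleGraph W) (G : SimpleGraph V) :
    ∀ k, Finite (hLineIter H G k).1
  | 0 => ‹Finite V›
  | k + 1 =>
    have := finite_hLineIter H G k
    inferInstanceAs (Finite (hLineIter H G k).2.edgeSet)

theorem divergesByOrder_of_hasChordedCycle [Finite V] {n m t : ℕ} (hn : 4 ≤ n) (hm : n ≤ m)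
    (h : HasChordedCycle (hLineIter (pathGraph n) G t).2 m) :
    DivergesByOrder (pathGraph n) G := by
  have key : ∀ i, HasChordedCycle (hLineIter (pathGraph n) G (t + i)).2 (m + i) := by
    intro i
    induction i with
    | zero => exact h
    | succ i ih => exact ih.hLineGraph_succ hn (by lia)
  intro N _
  obtain ⟨v, hv, -⟩ := key N
  -- `Nat.card` is `0` on infinite types, so the bound needs finiteness.
  have := finite_hLineIter (pathGraph n) G (t + N)
  exact ⟨t + N, le_trans (by lia) hv.le_card⟩

end Iterates

/-! ### Longest cycles and the characterization of `C_m` -/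

section Circumference

variable {V : Type u} {G : SimpleGraph V} {m : ℕ}

/-- On `ℕ`, `sSup` is `0` for empty and for unbounded sets; a positive value rules out both, so the
supremum is attained. -/
theorem exists_isCycle_of_circumference_pos (h : 0 < circumference G) :
    ∃ (v : V) (c : G.Walk v v), c.IsCycle ∧ c.length = circumference G := by
  have hne : {l : ℕ | ∃ (v : V) (c : G.Walk v v), c.IsCycle ∧ c.length = l}.Nonempty := by
    by_contra hne
    rw [Set.not_nonempty_iff_eq_empty] at hne
    simp [circumference, hne] at h
  have hbdd : BddAbove {l : ℕ | ∃ (v : V) (c : G.Walk v v), c.IsCycle ∧ c.length = l} := by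
    by_contra hb
    rw [circumference, Nat.sSup_of_not_bddAbove hb] at h
    exact h.false
  exact Nat.sSup_mem hne hbdd

/-- A cycle of length `m`, traversed periodically. -/
structure IsPeriodicCycle (G : SimpleGraph V) (m : ℕ) (u : ℕ → V) : Prop where
  eq_iff : ∀ i j, u i = u j ↔ i % m = j % m
  adj : ∀ i, G.Adj (u i) (u (i + 1))

theorem exists_isPeriodicCycle {x : V} {c : G.Walk x x} (hc : c.IsCycle) :
    ∃ u, IsPeriodicCycle G c.length u := by
  have h3 := hc.three_le_length
  refine ⟨fun i => c.getVert (i % c.length), fun i j => ⟨fun h => ?_, fun h => by simp only [h]⟩,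
    fun i => ?_⟩
  · have hi := Nat.mod_lt i (show 0 < c.length by lia)
    have hj := Nat.mod_lt j (show 0 < c.length by lia)
    exact hc.getVert_injOn' (show i % c.length ≤ c.length - 1 by lia)
      (show j % c.length ≤ c.length - 1 by lia) h
  · have hi := Nat.mod_lt i (show 0 < c.length by lia)
    have := c.adj_getVert_succ hi
    rcases (show i % c.length + 1 ≤ c.length from hi).lt_or_eq with h | h
    · rwa [← Nat.mod_add_mod, Nat.mod_eq_of_lt h]
    · rw [h, c.getVert_length] at this
      rwa [← Nat.mod_add_mod, h, Nat.mod_self, c.getVert_zero]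

/-- Rotation lets a chord or pendant edge at any cycle vertex be treated as one at index `0`. -/
theorem IsPeriodicCycle.isCycleSeq {u : ℕ → V} (h : IsPeriodicCycle G m u) (a : ℕ) :
    IsCycleSeq G m (fun i => u (a + i)) := by
  refine ⟨fun i hi j hj hij => ?_, ?_, fun i _ => h.adj (a + i)⟩
  · have := Nat.ModEq.add_left_cancel' a ((h.eq_iff _ _).1 hij)
    rwa [Nat.ModEq, Nat.mod_eq_of_lt hi, Nat.mod_eq_of_lt hj] at this
  · exact (h.eq_iff _ _).2 (by simp)

/-- A connected graph with a cycle of length `m`, but with neither a chord nor a pendant edge on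
a cycle of that length, is that cycle. -/
theorem IsPeriodicCycle.nonempty_iso {u : ℕ → V} (h : IsPeriodicCycle G m u) (hm : 3 ≤ m)
    (hconn : G.Connected) (hchord : ¬ HasChordedCycle G m) (hpend : ¬ HasPendantCycle G m) :
    Nonempty (G ≃g cycleGraph m) := by
  have hnb : ∀ a x, G.Adj (u a) x → ∃ b, u b = x := by
    intro a x hax
    by_contra! hx
    exact hpend ⟨_, h.isCycleSeq a, x, fun i _ => hx _, hax⟩
  -- By `hnb` no edge leaves the cycle, so a walk starting on it stays on it.
  have hsurj : ∀ x, ∃ b, u b = x := by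
    intro x
    obtain ⟨p⟩ := hconn.preconnected (u 0) x
    have key : ∀ {y z : V} (_ : G.Walk y z), (∃ b, u b = y) → ∃ b, u b = z := by
      intro y z p
      induction p with
      | nil => exact id
      | cons hadj _ ih =>
        rintro ⟨b, rfl⟩
        exact ih (hnb b _ hadj)
    exact key p ⟨0, rfl⟩
  have hlt : ∀ a b, a < b → b < m → (G.Adj (u a) (u b) ↔ b = a + 1 ∨ (a = 0 ∧ b + 1 = m)) := by
    intro a b hab hb
    constructor
    · intro hadj
      by_contra hcon
      refine hchord ⟨_, h.isCycleSeq a, b - a, by lia, by lia, ?_⟩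
      simpa [show a + (b - a) = b by lia] using hadj
    · rintro (rfl | ⟨rfl, hb⟩)
      · exact h.adj a
      · have := h.adj b
        rw [hb, (h.eq_iff m 0).2 (by simp)] at this
        exact this.symm
  have hcyc : ∀ a b : Fin m, a < b → ((cycleGraph m).Adj a b ↔
      (b : ℕ) = a + 1 ∨ ((a : ℕ) = 0 ∧ (b : ℕ) + 1 = m)) := by
    intro a b hab
    have hb := b.2
    have hab' : (a : ℕ) < b := hab
    -- For `a < b`, the difference `a - b` wraps around to `m - (b - a)`, which is `1` only for `a =
    -- 0`, `b = m - 1`.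
    rw [cycleGraph_adj', Fin.sub_val_of_le hab.le, Fin.val_sub, Nat.mod_eq_of_lt (by lia)]
    lia
  have hadj : ∀ a b : Fin m, G.Adj (u a) (u b) ↔ (cycleGraph m).Adj a b := by
    intro a b
    rcases lt_trichotomy a b with hab | rfl | hab
    · rw [hlt a b hab b.2, hcyc a b hab]
    · simp
    · rw [G.adj_comm, (cycleGraph m).adj_comm, hlt b a hab a.2, hcyc b a hab]
  have hbij : Function.Bijective (fun i : Fin m => u i) := by
    refine ⟨fun a b hab => ?_, fun x => ?_⟩
    · have := (h.eq_iff _ _).1 hab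
      rwa [Nat.mod_eq_of_lt a.2, Nat.mod_eq_of_lt b.2, ← Fin.ext_iff] at this
    · obtain ⟨b, rfl⟩ := hsurj x
      exact ⟨⟨b % m, Nat.mod_lt _ (by lia)⟩, (h.eq_iff _ _).2 (by simp)⟩
  let f : cycleGraph m ≃g G := ⟨Equiv.ofBijective _ hbij, fun {a b} => hadj a b⟩
  exact ⟨f.symm⟩

end Circumference

/-! ### Transfer from a subgraph to the whole graph -/

section Monotonicity

variable {V V' : Type*} {G : SimpleGraph V} {G' : SimpleGraph V'} {k : ℕ}

theorem IsCycleSeq.map {v : ℕ → V'} (h : IsCycleSeq G' k v) (f : Copy G' G) :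
    IsCycleSeq G k (fun i => f (v i)) :=
  ⟨fun i hi j hj hij => h.inj i hi j hj (f.injective hij), congrArg f h.closed,
    fun i hi => f.toHom.map_adj (h.adj i hi)⟩

theorem HasChordedCycle.map (h : HasChordedCycle G' k) (f : Copy G' G) :
    HasChordedCycle G k :=
  let ⟨_, hv, j, hj, hjk, hadj⟩ := h
  ⟨_, hv.map f, j, hj, hjk, f.toHom.map_adj hadj⟩

theorem HasPendantCycle.map (h : HasPendantCycle G' k) (f : Copy G' G) :
    HasPendantCycle G k :=
  let ⟨_, hv, x, hx, hadj⟩ := h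
  ⟨_, hv.map f, f x, fun i hi hix => hx i hi (f.injective hix), f.toHom.map_adj hadj⟩

end Monotonicity

end HLine

theorem theorem3 {V : Type u} [Finite V] (n : ℕ) (hn : 4 ≤ n) (G : SimpleGraph V)
    (G' : G.Subgraph) (hconn : G'.Connected) (m : ℕ)
    (hcirc : HLine.circumference G'.coe = m) (hmn : n ≤ m)
    (hne : ¬ Nonempty (G'.coe ≃g SimpleGraph.cycleGraph m)) :
    HLine.DivergesByOrder (SimpleGraph.pathGraph n) G := by
  obtain ⟨x, c, hc, hlen⟩ :=
    HLine.exists_isCycle_of_circumference_pos (G := G'.coe) (by lia)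
  obtain ⟨u, hu⟩ := HLine.exists_isPeriodicCycle hc
  rw [hlen, hcirc] at hu
  let f : SimpleGraph.Copy G'.coe G := ⟨G'.hom, Subtype.val_injective⟩
  by_cases hchord : HLine.HasChordedCycle G'.coe m
  · exact HLine.divergesByOrder_of_hasChordedCycle (t := 0) hn hmn (hchord.map f)
  by_cases hpend : HLine.HasPendantCycle G'.coe m
  -- The pendant edge becomes part of a chorded cycle only after one iterate, hence the start at `t
  -- = 1` with length `m + 1`.
  · exact HLine.divergesByOrder_of_hasChordedCycle (t := 1) (m := m + 1) hn (by lia)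
      ((hpend.map f).hLineGraph_succ hn hmn)
  exact (hne (hu.nonempty_iso (by lia) hconn.coe hchord hpend)).elim
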